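/- There are constants $C, C', C'' > 0$ such that for every sufficiently large integer $n$ there is a triangle-free graph $G$ on $n$ vertices, with all degrees between $C' n^{1/3}$ and $C'' n^{1/3}$, that contains no semi-bipartite induced subgraph of average degree at least $C \log n$. Here an induced subgraph of $G$ is semi-bipartite if its vertex set admits a partition $V_1 \cup V_2$ such that $V_1$ is a stable (independent) set of $G$, and its average degree with respect to this semi-bipartition is the average degree of the bipartite subgraph $G[V_1,V_2]$ between $V_1$ and $V_2$, that is, $2e(V_1,V_2)/(|V_1|+|V_2|)$, where $e(V_1,V_2)$ is the number of edges with one end in $V_1$ and the other in $V_2$ (edges inside $V_2$ are ignored). -/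

import Mathlib

/-- For vertex sets `A`, `B` (used for disjoint ones), the average degree `2 e(A,B) / (|A| + |B|)`
of the bipartite subgraph `G[A,B]`, whose vertex set is `A ∪ B` and whose edges are the edges
of `G` with one end in `A` and the other in `B`. Edges inside `A` or inside `B` are ignored. -/
noncomputable def bipAverageDegree {V : Type*} (G : SimpleGraph V) [DecidableRel G.Adj]
    (A B : Finset V) : ℝ :=
  2 * ((G.interedges A B).card : ℝ) / ((A.card : ℝ) + (B.card : ℝ))

/-- `G` contains a semi-bipartite induced subgraph of average degree at least `t`: there are
disjoint vertex sets `A` and `B`, not both empty, with `A` stable in `G`, such that the average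
degree of `G[A,B]` is at least `t`. The induced subgraph is the one on `A ∪ B`. -/
def HasSemiBipartiteInducedSubgraph {V : Type*} (G : SimpleGraph V) [DecidableRel G.Adj]
    (t : ℝ) : Prop :=
  ∃ A B : Finset V, Disjoint A B ∧ (A.Nonempty ∨ B.Nonempty) ∧
    G.IsIndepSet (A : Set V) ∧ t ≤ bipAverageDegree G A B

/-! Take a random graph with edge probability `p = n^(-2/3)/6`. Triangles are so rare that few
vertices lie in one, degrees are `O(pn)`, and stable sets have size `O(log n / p)`. A stable `A` and
a set `B` thus expect only `p|A||B| = O(log n)|B|` edges between them, and exponential moments make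
this hold up to constants for all pairs at once (`exists_graph_sparse_from_stable`).

Two deterministic repairs follow. `exists_core` finds a set `W` of at least `n/96` vertices that
avoids all triangles and induces minimum degree of order `pn`. Pulling the graph back along a map
from `n` vertices onto `W` with fibres of size at most 96 restores the vertex count: it creates no
triangle, keeps degrees of order `n^(1/3)`, and raises densities by at most `96^2`
(`card_interedges_comap_le_of_sparse`). -/

open Finset

/-! ### Moments of a random subset -/

/-- The expectation of `f E`, where the random set `E` contains each element of the finite type `α`
independently with probability `p`. -/
noncomputable def bernoulliExp {α : Type*} [Fintype α] [DecidableEq α] (p : ℝ)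
    (f : Finset α → ℝ) : ℝ :=
  ∑ E : Finset α, ((∏ _i ∈ E, p) * ∏ _i ∈ Eᶜ, (1 - p)) * f E

namespace bernoulliExp

variable {α : Type*} [Fintype α] [DecidableEq α] {p : ℝ}

theorem weight_nonneg (hp0 : 0 ≤ p) (hp1 : p ≤ 1) (E : Finset α) :
    0 ≤ (∏ _i ∈ E, p) * ∏ _i ∈ Eᶜ, (1 - p) :=
  mul_nonneg (prod_nonneg fun _ _ => hp0) (prod_nonneg fun _ _ => by linarith)

theorem eq_prod (a b : α → ℝ) :
    bernoulliExp p (fun E => (∏ i ∈ E, a i) * ∏ i ∈ Eᶜ, b i) = ∏ i, (p * a i + (1 - p) * b i) := by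
  rw [Fintype.prod_add]
  refine sum_congr rfl fun E _ => ?_
  rw [prod_mul_distrib, prod_mul_distrib]
  ring

theorem const_one : bernoulliExp (α := α) p (fun _ => 1) = 1 := by
  simpa using eq_prod (p := p) (fun _ : α => 1) (fun _ => 1)

theorem mono (hp0 : 0 ≤ p) (hp1 : p ≤ 1) {f g : Finset α → ℝ} (h : ∀ E, f E ≤ g E) :
    bernoulliExp p f ≤ bernoulliExp p g :=
  sum_le_sum fun E _ => mul_le_mul_of_nonneg_left (h E) (weight_nonneg hp0 hp1 E)

theorem add (f g : Finset α → ℝ) :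
    bernoulliExp p (fun E => f E + g E) = bernoulliExp p f + bernoulliExp p g := by
  simp only [bernoulliExp, mul_add, sum_add_distrib]

theorem const_mul (c : ℝ) (f : Finset α → ℝ) :
    bernoulliExp p (fun E => c * f E) = c * bernoulliExp p f := by
  simp only [bernoulliExp, mul_sum]
  exact sum_congr rfl fun E _ => by ring

theorem sum {ι : Type*} (s : Finset ι) (f : ι → Finset α → ℝ) :
    bernoulliExp p (fun E => ∑ i ∈ s, f i E) = ∑ i ∈ s, bernoulliExp p (f i) := by
  simp only [bernoulliExp, mul_sum]
  exact sum_comm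

theorem exists_lt_one (hp0 : 0 ≤ p) (hp1 : p ≤ 1) {f : Finset α → ℝ}
    (h : bernoulliExp p f < 1) : ∃ E, f E < 1 := by
  by_contra! hc
  have := mono hp0 hp1 hc
  rw [const_one] at this
  linarith

theorem pow_card_inter (s : ℝ) (F : Finset α) :
    bernoulliExp p (fun E => s ^ #(E ∩ F)) = (1 + p * (s - 1)) ^ #F := by
  have h := eq_prod (p := p) (fun i => if i ∈ F then s else 1) (fun _ : α => 1)
  simp only [prod_const_one, mul_one] at h
  have h1 : ∀ E : Finset α, (∏ i ∈ E, if i ∈ F then s else 1) = s ^ #(E ∩ F) := fun E => by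
    rw [prod_ite_mem, prod_const]
  simp only [h1] at h
  rw [h, ← prod_const, ← prod_subset (subset_univ F)]
  · refine prod_congr rfl fun i hi => ?_
    rw [if_pos hi]; ring
  · intro i _ hi
    rw [if_neg hi]; ring

/-- Each element of `F` contributes a factor `1 + p(e - 1) ≤ 1 + 2p ≤ e^(2p)`. -/
theorem exp_card_inter_le (hp0 : 0 ≤ p) (F : Finset α) :
    bernoulliExp p (fun E => Real.exp (#(E ∩ F) : ℝ)) ≤ Real.exp (2 * p * #F) := by
  have h := pow_card_inter (p := p) (Real.exp 1) F
  simp only [← Real.exp_nat_mul, mul_one] at h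
  rw [h, mul_comm (2 * p), Real.exp_nat_mul]
  have he := Real.add_one_le_exp 1
  have he' := Real.exp_one_lt_d9
  refine pow_le_pow_left₀ (by nlinarith) ?_ _
  have := Real.add_one_le_exp (2 * p)
  nlinarith

/-- Each factor is `1 - p(1 - 1/e) ≤ 1 - p/2 ≤ e^(-p/2)`. -/
theorem exp_neg_card_inter_le (hp0 : 0 ≤ p) (hp1 : p ≤ 1) (F : Finset α) :
    bernoulliExp p (fun E => Real.exp (-(#(E ∩ F) : ℝ))) ≤ Real.exp (-(p * #F / 2)) := by
  have h := pow_card_inter (p := p) (Real.exp (-1)) F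
  simp only [← Real.exp_nat_mul, mul_neg, mul_one] at h
  rw [h, show -(p * #F / 2) = #F * (-(p / 2)) by ring, Real.exp_nat_mul]
  have he : Real.exp (-1) ≤ 1 / 2 := by
    rw [Real.exp_neg, one_div]
    exact inv_anti₀ (by norm_num) (by linarith [Real.add_one_le_exp 1])
  have h0 := Real.exp_pos (-1)
  refine pow_le_pow_left₀ (by nlinarith) ?_ _
  have := Real.add_one_le_exp (-(p / 2))
  nlinarith

theorem indicator_subset (F : Finset α) :
    bernoulliExp p (fun E => if F ⊆ E then 1 else 0) = p ^ #F := by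
  have h := eq_prod (p := p) (fun _ : α => 1) (fun i => if i ∈ F then 0 else 1)
  simp only [prod_const_one, one_mul, mul_one] at h
  have h1 : ∀ E : Finset α, (∏ i ∈ Eᶜ, if i ∈ F then (0 : ℝ) else 1) =
      if F ⊆ E then 1 else 0 := fun E => by
    split_ifs with hE
    · exact prod_eq_one fun i hi => if_neg fun hF => (mem_compl.1 hi) (hE hF)
    · obtain ⟨i, hiF, hiE⟩ := not_subset.1 hE
      exact prod_eq_zero (mem_compl.2 hiE) (if_pos hiF)
  simp only [h1] at h
  rw [h, ← prod_const, ← prod_subset (subset_univ F)]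
  · refine prod_congr rfl fun i hi => ?_
    rw [if_pos hi]; ring
  · intro i _ hi
    rw [if_neg hi]; ring

end bernoulliExp

/-! ### Deterministic repairs: core and blow-up -/

/-- Blowing up the vertices of a vertex set of linear size. -/
theorem exists_balanced_map {n k : ℕ} (hn : 0 < n) (W : Finset (Fin n)) (hW : n ≤ k * #W) :
    ∃ f : Fin n → Fin n, (∀ v, f v ∈ W) ∧ (∀ w ∈ W, ∃ v, f v = w) ∧
      ∀ w, #{v | f v = w} ≤ k := by
  have hm : 0 < #W := by
    rcases Nat.eq_zero_or_pos #W with h | h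
    · rw [h] at hW; omega
    · exact h
  have hWn : #W ≤ n := by simpa using card_le_univ W
  let e := W.equivFin.symm
  -- Reduce modulo `#W`; within a fibre, `v` is determined by its quotient `v / #W < k`.
  refine ⟨fun v => e ⟨v % #W, Nat.mod_lt _ hm⟩, fun v => (e _).2, fun w hw => ?_, fun w => ?_⟩
  · have hlt := (W.equivFin ⟨w, hw⟩).2
    refine ⟨⟨W.equivFin ⟨w, hw⟩, hlt.trans_le hWn⟩, ?_⟩
    simp [e, Nat.mod_eq_of_lt hlt]
  · rw [← card_range k]
    refine card_le_card_of_injOn (fun v => (v : ℕ) / #W) (fun v _ => ?_) ?_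
    · have := v.2
      simp only [coe_range, Set.mem_Iio]
      exact Nat.div_lt_of_lt_mul (by rw [mul_comm]; omega)
    · intro u hu v hv huv
      simp only [coe_filter, mem_univ, true_and, Set.mem_ofPred_eq] at hu hv
      have h := e.injective (Subtype.ext (hu.trans hv.symm))
      simp only [Fin.mk.injEq] at h
      ext
      rw [← Nat.div_add_mod u #W, ← Nat.div_add_mod v #W, h]
      simp only at huv
      rw [huv]

theorem card_le_mul_card_of_fiber_le {α β : Type*} [DecidableEq β] {f : α → β} {k : ℕ}
    (s : Finset α) (t : Finset β) (hst : ∀ a ∈ s, f a ∈ t)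
    (hf : ∀ b ∈ t, #{a ∈ s | f a = b} ≤ k) : #s ≤ k * #t := by
  rw [mul_comm, ← smul_eq_mul]
  rw [card_eq_sum_card_fiberwise hst]
  exact sum_le_card_nsmul _ _ _ hf

/-- Maximise `g W - 2δ|W|` over sets avoiding `T`, where `g W` is twice the number of edges inside
`W`. Deleting `v` lowers `g` by twice its degree in `W`, so maximality forces degree at least `δ`.
Comparison with `Tᶜ` bounds the size from below. -/
theorem exists_core {V : Type*} [Fintype V] [DecidableEq V] (G : SimpleGraph V)
    [DecidableRel G.Adj] (T : Finset V) {D δ : ℝ} (hδ : 0 ≤ δ)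
    (hD : ∀ v, (G.degree v : ℝ) ≤ D) :
    ∃ W : Finset V, Disjoint W T ∧ (∀ v ∈ W, δ ≤ #(G.neighborFinset v ∩ W)) ∧
      ∑ v, (G.degree v : ℝ) - 2 * D * #T - 2 * δ * Fintype.card V ≤ D * #W := by
  classical
  let g : Finset V → ℝ := fun W => ∑ v ∈ W, (#(G.neighborFinset v ∩ W) : ℝ)
  obtain ⟨W, hWT, hmax⟩ := exists_max_image Tᶜ.powerset (fun W => g W - 2 * δ * #W)
    ⟨Tᶜ, mem_powerset_self _⟩
  have hcount : ∀ (S : Finset V), ∀ v ∈ S,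
      g S = g (S.erase v) + 2 * #(G.neighborFinset v ∩ S) := by
    intro S v hv
    simp only [g]
    rw [← add_sum_erase S _ hv]
    have h1 : ∀ u ∈ S.erase v, (#(G.neighborFinset u ∩ S) : ℝ) =
        #(G.neighborFinset u ∩ S.erase v) + if u ∈ G.neighborFinset v then 1 else 0 := by
      intro u hu
      rw [inter_erase]
      split_ifs with h
      · have : v ∈ G.neighborFinset u ∩ S := by
          simp only [mem_inter, SimpleGraph.mem_neighborFinset] at h ⊢
          exact ⟨h.symm, hv⟩
        exact_mod_cast (card_erase_add_one this).symm
      · rw [erase_eq_of_notMem, add_zero]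
        simp only [mem_inter, SimpleGraph.mem_neighborFinset] at h ⊢
        exact fun hh => h hh.1.symm
    rw [sum_congr rfl h1, sum_add_distrib, ← sum_filter, sum_const, nsmul_eq_mul, mul_one]
    have h2 : (S.erase v).filter (· ∈ G.neighborFinset v) = G.neighborFinset v ∩ S := by
      ext u
      simp only [mem_filter, mem_erase, mem_inter, SimpleGraph.mem_neighborFinset]
      exact ⟨fun h => ⟨h.2, h.1.2⟩, fun h => ⟨⟨h.1.ne', h.2⟩, h.1⟩⟩
    rw [h2]
    ring
  have hD' : ∀ v (S : Finset V), (#(G.neighborFinset v ∩ S) : ℝ) ≤ D := fun v S =>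
    le_trans (by exact_mod_cast card_le_card inter_subset_left) (hD v)
  have hcompl : ∀ S : Finset V, g univ - 2 * D * #S ≤ g Sᶜ := by
    intro S
    induction S using Finset.induction_on with
    | empty => simp
    | insert v S hv ih =>
      have h := hcount Sᶜ v (mem_compl.2 hv)
      have hv' := hD' v Sᶜ
      rw [compl_insert, card_insert_of_notMem hv]
      push_cast
      linarith
  refine ⟨W, ?_, fun v hv => ?_, ?_⟩
  · rw [mem_powerset] at hWT
    exact disjoint_left.2 fun v hv hT => (mem_compl.1 (hWT hv)) hT
  · have h := hmax (W.erase v) (mem_powerset.2 ((erase_subset _ _).trans (mem_powerset.1 hWT)))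
    have h1 := hcount W v hv
    have h2 : (#(W.erase v) : ℝ) + 1 = #W := by exact_mod_cast card_erase_add_one hv
    rw [← h2] at h
    linarith
  · have h := hmax Tᶜ (mem_powerset_self _)
    have h1 := hcompl T
    have h2 : g univ = ∑ v, (G.degree v : ℝ) := by simp [g]
    have h3 : g W ≤ D * #W := by
      refine (sum_le_card_nsmul W _ D fun v _ => hD' v W).trans ?_
      rw [nsmul_eq_mul, mul_comm]
    have h4 : (#Tᶜ : ℝ) ≤ Fintype.card V := by exact_mod_cast card_le_univ _
    have h5 : 0 ≤ δ * #W := by positivity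
    have h6 := mul_le_mul_of_nonneg_left h4 hδ
    linarith

/-- Pulling back along a map with bounded fibres changes densities by a bounded factor. -/
theorem card_interedges_comap_le {V V' : Type*} [DecidableEq V'] {G : SimpleGraph V'}
    [DecidableRel G.Adj] {f : V → V'} [DecidableRel (G.comap f).Adj] [Fintype V] {k : ℕ}
    (hf : ∀ w, #{v | f v = w} ≤ k) (A B : Finset V) :
    #((G.comap f).interedges A B) ≤ k ^ 2 * #(G.interedges (A.image f) (B.image f)) := by
  classical
  refine card_le_mul_card_of_fiber_le (f := Prod.map f f) _ _ ?_ ?_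
  · rintro ⟨a, b⟩ h
    rw [SimpleGraph.mem_interedges_iff] at h
    rw [Prod.map_apply, SimpleGraph.mem_interedges_iff]
    exact ⟨mem_image_of_mem f h.1, mem_image_of_mem f h.2.1, h.2.2⟩
  · rintro ⟨x, y⟩ -
    have hsub : {e ∈ (G.comap f).interedges A B | Prod.map f f e = (x, y)} ⊆
        ({v | f v = x} : Finset V) ×ˢ ({v | f v = y} : Finset V) := by
      rintro ⟨a, b⟩ h
      simpa using (mem_filter.1 h).2
    refine (card_le_card hsub).trans ?_
    rw [card_product, sq]
    exact Nat.mul_le_mul (hf x) (hf y)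

/-- If the bipartite subgraphs between a stable set and a disjoint set are sparse, then so are
those of a blow-up. -/
theorem card_interedges_comap_le_of_sparse {V V' : Type*} [DecidableEq V'] {G : SimpleGraph V'}
    [DecidableRel G.Adj] {f : V → V'} [DecidableRel (G.comap f).Adj] [Fintype V] {k : ℕ}
    (hf : ∀ w, #{v | f v = w} ≤ k) {c : ℝ} (hc : 0 ≤ c)
    (hG : ∀ A B : Finset V', Disjoint A B → G.IsIndepSet (A : Set V') →
      (#(G.interedges A B) : ℝ) ≤ c * (#A + #B)) {A B : Finset V}
    (hA : (G.comap f).IsIndepSet (A : Set V)) :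
    (#((G.comap f).interedges A B) : ℝ) ≤ (k ^ 2 : ℝ) * (c * (#A + #B)) := by
  have hA' : G.IsIndepSet (A.image f : Set V') := by
    intro x hx y hy _ hadj
    simp only [coe_image, Set.mem_image, mem_coe] at hx hy
    obtain ⟨a, ha, rfl⟩ := hx
    obtain ⟨b, hb, rfl⟩ := hy
    have hab : a ≠ b := by rintro rfl; exact hadj.ne rfl
    exact hA ha hb hab hadj
  -- The images may overlap even for disjoint `A` and `B`, but stability of the image of `A` means
  -- the overlap carries no edges.
  have h1 : G.interedges (A.image f) (B.image f) ⊆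
      G.interedges (A.image f) (B.image f \ A.image f) := by
    rintro ⟨x, y⟩ h
    rw [SimpleGraph.mem_interedges_iff] at h ⊢
    refine ⟨h.1, mem_sdiff.2 ⟨h.2.1, fun hy => ?_⟩, h.2.2⟩
    exact hA' (mem_coe.2 h.1) (mem_coe.2 hy) h.2.2.ne h.2.2
  have h2 := hG (A.image f) (B.image f \ A.image f) disjoint_sdiff hA'
  have h3 : (#(G.interedges (A.image f) (B.image f)) : ℝ) ≤ c * (#A + #B) := by
    refine le_trans (by exact_mod_cast card_le_card h1) (h2.trans ?_)
    refine mul_le_mul_of_nonneg_left (add_le_add ?_ ?_) hc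
    · exact_mod_cast card_image_le
    · exact_mod_cast (card_le_card sdiff_subset).trans card_image_le
  calc (#((G.comap f).interedges A B) : ℝ)
      ≤ (k ^ 2 : ℝ) * #(G.interedges (A.image f) (B.image f)) := by
        exact_mod_cast card_interedges_comap_le hf A B
    _ ≤ _ := mul_le_mul_of_nonneg_left h3 (by positivity)

theorem two_mul_card_le_sum_degree {V : Type*} [Fintype V] (G : SimpleGraph V) [DecidableRel G.Adj]
    {F : Finset (Sym2 V)} (hF : ∀ e ∈ F, e ∈ G.edgeSet) : 2 * #F ≤ ∑ v, G.degree v := by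
  rw [SimpleGraph.sum_degrees_eq_twice_card_edges]
  exact Nat.mul_le_mul_left 2 (card_le_card fun e he => SimpleGraph.mem_edgeFinset.2 (hF e he))

/-! ### Graphs as sets of unordered pairs -/

section EdgeSets

variable {V : Type*} [DecidableEq V]

/-- The unordered pairs with one entry in `A` and the other in `B`. -/
def crossPairs (A B : Finset V) : Finset (Sym2 V) := (A ×ˢ B).image fun e => s(e.1, e.2)

theorem card_crossPairs_le (A B : Finset V) : #(crossPairs A B) ≤ #A * #B :=
  card_image_le.trans_eq (card_product A B)

theorem mk_mem_crossPairs {A B : Finset V} {a b : V} (ha : a ∈ A) (hb : b ∈ B) :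
    s(a, b) ∈ crossPairs A B :=
  mem_image.2 ⟨(a, b), mem_product.2 ⟨ha, hb⟩, rfl⟩

/-- The unordered pairs of distinct elements of `A`. -/
def innerPairs (A : Finset V) : Finset (Sym2 V) := A.offDiag.image fun e => s(e.1, e.2)

theorem card_innerPairs (A : Finset V) : (#(innerPairs A) : ℝ) = #A * (#A - 1) / 2 := by
  have h : #(innerPairs A) = (#A).choose 2 := Sym2.card_image_offDiag A
  rw [h, Nat.cast_choose_two]

theorem inter_innerPairs_eq_empty (E : Finset (Sym2 V)) {A : Finset V}
    (hA : (SimpleGraph.fromEdgeSet (E : Set (Sym2 V))).IsIndepSet (A : Set V)) :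
    E ∩ innerPairs A = ∅ := by
  refine eq_empty_of_forall_notMem fun e he => ?_
  obtain ⟨heE, heA⟩ := mem_inter.1 he
  obtain ⟨⟨a, b⟩, hab, rfl⟩ := mem_image.1 heA
  obtain ⟨ha, hb, hne⟩ := mem_offDiag.1 hab
  exact hA ha hb hne ((SimpleGraph.fromEdgeSet_adj _).2 ⟨heE, hne⟩)

variable (E : Finset (Sym2 V)) [DecidableRel (SimpleGraph.fromEdgeSet (E : Set (Sym2 V))).Adj]

theorem card_interedges_fromEdgeSet_le {A B : Finset V} (h : Disjoint A B) :
    #((SimpleGraph.fromEdgeSet (E : Set (Sym2 V))).interedges A B) ≤ #(E ∩ crossPairs A B) := by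
  refine card_le_card_of_injOn (fun e => s(e.1, e.2)) ?_ ?_
  · rintro ⟨a, b⟩ hab
    rw [mem_coe, SimpleGraph.mem_interedges_iff, SimpleGraph.fromEdgeSet_adj] at hab
    exact mem_coe.2 (mem_inter.2 ⟨hab.2.2.1, mk_mem_crossPairs hab.1 hab.2.1⟩)
  · rintro ⟨a, b⟩ hab ⟨c, d⟩ hcd he
    rw [mem_coe, SimpleGraph.mem_interedges_iff] at hab hcd
    rcases Sym2.eq_iff.1 he with ⟨h1, h2⟩ | ⟨h1, h2⟩
    · exact Prod.ext h1 h2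
    · simp only at h1
      exact absurd (h1 ▸ hab.1) (fun hd => disjoint_left.1 h hd hcd.2.1)

theorem degree_fromEdgeSet_le [Fintype V] (v : V) :
    (SimpleGraph.fromEdgeSet (E : Set (Sym2 V))).degree v ≤ #(E ∩ crossPairs {v} univ) := by
  refine card_le_card_of_injOn (fun u => s(v, u)) ?_ ?_
  · intro u hu
    rw [mem_coe, SimpleGraph.mem_neighborFinset, SimpleGraph.fromEdgeSet_adj] at hu
    exact mem_coe.2 (mem_inter.2 ⟨hu.1, mk_mem_crossPairs (mem_singleton_self v) (mem_univ u)⟩)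
  · intro a _ b _ h
    exact Sym2.congr_right.1 h

theorem two_mul_card_inter_innerPairs_le_sum_degree [Fintype V] :
    2 * #(E ∩ innerPairs univ) ≤
      ∑ v, (SimpleGraph.fromEdgeSet (E : Set (Sym2 V))).degree v := by
  refine two_mul_card_le_sum_degree _ fun e he => ?_
  obtain ⟨heE, heA⟩ := mem_inter.1 he
  obtain ⟨⟨a, b⟩, hab, rfl⟩ := mem_image.1 heA
  rw [SimpleGraph.mem_edgeSet, SimpleGraph.fromEdgeSet_adj]
  exact ⟨heE, (mem_offDiag.1 hab).2.2⟩

end EdgeSets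

/-! ### Expected weights of the bad events -/

theorem sum_finset_pow_card {V : Type*} [Fintype V] (q : ℝ) :
    ∑ A : Finset V, q ^ #A = (1 + q) ^ Fintype.card V := by
  rw [add_comm, Fintype.sum_pow_mul_eq_add_pow V q 1 |>.symm]
  simp

theorem one_add_pow_le_exp {q : ℝ} (hq : 0 ≤ q) (n : ℕ) : (1 + q) ^ n ≤ Real.exp (n * q) := by
  rw [Real.exp_nat_mul]
  exact pow_le_pow_left₀ (by linarith) (by linarith [Real.add_one_le_exp q]) n

section Moments

variable {V : Type*} [Fintype V] [DecidableEq V] {p L : ℝ}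

theorem bernoulliExp_triangles_le (hp0 : 0 ≤ p) :
    bernoulliExp p (fun E : Finset (Sym2 V) => ∑ t : V × V × V with
        t.1 ≠ t.2.1 ∧ t.1 ≠ t.2.2 ∧ t.2.1 ≠ t.2.2,
        if ({s(t.1, t.2.1), s(t.1, t.2.2), s(t.2.1, t.2.2)} : Finset (Sym2 V)) ⊆ E
          then (1 : ℝ) else 0) ≤ (Fintype.card V : ℝ) ^ 3 * p ^ 3 := by
  rw [bernoulliExp.sum]
  have h : ∀ t ∈ ({t | t.1 ≠ t.2.1 ∧ t.1 ≠ t.2.2 ∧ t.2.1 ≠ t.2.2} : Finset (V × V × V)),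
      bernoulliExp p (fun E : Finset (Sym2 V) =>
        if ({s(t.1, t.2.1), s(t.1, t.2.2), s(t.2.1, t.2.2)} : Finset (Sym2 V)) ⊆ E
          then (1 : ℝ) else 0) ≤ p ^ 3 := by
    rintro ⟨a, b, c⟩ ht
    simp only [mem_filter, mem_univ, true_and] at ht
    obtain ⟨hab, hac, hbc⟩ := ht
    rw [bernoulliExp.indicator_subset, card_eq_three.2 ⟨_, _, _, ?_, ?_, ?_, rfl⟩]
    · simpa [hbc] using fun h => absurd h hac
    · simp [hab, hac]
    · simp [hab, hac]
  refine (sum_le_card_nsmul _ _ _ h).trans ?_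
  rw [nsmul_eq_mul]
  refine mul_le_mul_of_nonneg_right ?_ (by positivity)
  have := card_le_univ ({t | t.1 ≠ t.2.1 ∧ t.1 ≠ t.2.2 ∧ t.2.1 ≠ t.2.2} : Finset (V × V × V))
  rw [Fintype.card_prod, Fintype.card_prod] at this
  calc _ ≤ ((Fintype.card V * (Fintype.card V * Fintype.card V) : ℕ) : ℝ) := by exact_mod_cast this
    _ = _ := by push_cast; ring

theorem bernoulliExp_few_edges_le (hp0 : 0 ≤ p) (hp1 : p ≤ 1) :
    bernoulliExp p (fun E : Finset (Sym2 V) => Real.exp (p * #(innerPairs (univ : Finset V)) / 4) *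
        Real.exp (-(#(E ∩ innerPairs univ) : ℝ))) ≤
      Real.exp (-(p * #(innerPairs (univ : Finset V)) / 4)) := by
  rw [bernoulliExp.const_mul]
  refine (mul_le_mul_of_nonneg_left (bernoulliExp.exp_neg_card_inter_le hp0 hp1 _)
    (Real.exp_nonneg _)).trans_eq ?_
  rw [← Real.exp_add]
  ring_nf

theorem bernoulliExp_large_degree_le (hp0 : 0 ≤ p) :
    bernoulliExp p (fun E : Finset (Sym2 V) => ∑ v : V,
        Real.exp (-(3 * p * Fintype.card V)) * Real.exp (#(E ∩ crossPairs {v} univ) : ℝ)) ≤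
      Fintype.card V * Real.exp (-(p * Fintype.card V)) := by
  rw [bernoulliExp.sum]
  have h : ∀ v ∈ (univ : Finset V), bernoulliExp p (fun E : Finset (Sym2 V) =>
      Real.exp (-(3 * p * Fintype.card V)) * Real.exp (#(E ∩ crossPairs {v} univ) : ℝ)) ≤
      Real.exp (-(p * Fintype.card V)) := by
    intro v _
    rw [bernoulliExp.const_mul]
    refine (mul_le_mul_of_nonneg_left (bernoulliExp.exp_card_inter_le hp0 _)
      (Real.exp_nonneg _)).trans ?_
    rw [← Real.exp_add, Real.exp_le_exp]
    have h1 : (#(crossPairs {v} (univ : Finset V)) : ℝ) ≤ Fintype.card V := by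
      exact_mod_cast (card_crossPairs_le {v} univ).trans (by simp)
    nlinarith
  refine (sum_le_card_nsmul _ _ _ h).trans ?_
  rw [nsmul_eq_mul, card_univ]

/-- A stable `A` contributes a full 1 to the sum. The size condition makes the expected number of
inner edges at least `4L|A|`, so each term has mean at most `e^(-2L|A|)`, and the binomial theorem
sums these; the `- 1` removes the empty set. -/
theorem bernoulliExp_large_stable_le (hp0 : 0 ≤ p) (hp1 : p ≤ 1) :
    bernoulliExp p (fun E : Finset (Sym2 V) =>
        ∑ A : Finset V with A.Nonempty ∧ 8 * L ≤ p * (#A - 1),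
          Real.exp (-(#(E ∩ innerPairs A) : ℝ))) ≤
      Real.exp (Fintype.card V * Real.exp (-(2 * L))) - 1 := by
  rw [bernoulliExp.sum]
  have h : ∀ A ∈ ({A | A.Nonempty ∧ 8 * L ≤ p * (#A - 1)} : Finset (Finset V)),
      bernoulliExp p (fun E : Finset (Sym2 V) => Real.exp (-(#(E ∩ innerPairs A) : ℝ))) ≤
        Real.exp (-(2 * L)) ^ #A := by
    intro A hA
    simp only [mem_filter, mem_univ, true_and] at hA
    refine (bernoulliExp.exp_neg_card_inter_le hp0 hp1 _).trans ?_
    rw [← Real.exp_nat_mul, Real.exp_le_exp, card_innerPairs]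
    have : (0 : ℝ) ≤ #A := by positivity
    nlinarith [mul_le_mul_of_nonneg_left hA.2 this]
  have hsub : ({A | A.Nonempty ∧ 8 * L ≤ p * (#A - 1)} : Finset (Finset V)) ⊆
      univ.erase ∅ := fun A hA => by
    simp only [mem_filter, mem_univ, true_and] at hA
    exact mem_erase.2 ⟨hA.1.ne_empty, mem_univ A⟩
  refine (sum_le_sum h).trans
    ((sum_le_sum_of_subset_of_nonneg hsub fun _ _ _ => by positivity).trans ?_)
  have h2 := add_sum_erase univ (fun A : Finset V => Real.exp (-(2 * L)) ^ #A) (mem_univ ∅)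
  rw [sum_finset_pow_card] at h2
  have h3 := one_add_pow_le_exp (Real.exp_nonneg (-(2 * L))) (Fintype.card V)
  simp only [card_empty, pow_zero] at h2
  linarith

/-- Here `p|A| ≤ 8L + p ≤ 9L`, so the exponential moment costs at most `18L|B|` of the budget
`20L(|A| + |B|)`. What remains gives each vertex weight `e^(-2L)`, enough for a union bound over all
pairs. -/
theorem bernoulliExp_dense_pair_le (hp0 : 0 ≤ p) (hpL : p ≤ L) :
    bernoulliExp p (fun E : Finset (Sym2 V) =>
        ∑ P : Finset V × Finset V with P ≠ (∅, ∅) ∧ p * (#P.1 - 1) < 8 * L,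
          Real.exp (-(20 * L * (#P.1 + #P.2))) *
            Real.exp (#(E ∩ crossPairs P.1 P.2) : ℝ)) ≤
      Real.exp (2 * (Fintype.card V * Real.exp (-(2 * L)))) - 1 := by
  rw [bernoulliExp.sum]
  have h : ∀ P ∈ ({P | P ≠ (∅, ∅) ∧ p * (#P.1 - 1) < 8 * L} : Finset (Finset V × Finset V)),
      bernoulliExp p (fun E : Finset (Sym2 V) => Real.exp (-(20 * L * (#P.1 + #P.2))) *
            Real.exp (#(E ∩ crossPairs P.1 P.2) : ℝ)) ≤
        Real.exp (-(2 * L)) ^ #P.1 * Real.exp (-(2 * L)) ^ #P.2 := by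
    rintro ⟨A, B⟩ hP
    simp only [mem_filter, mem_univ, true_and] at hP
    rw [bernoulliExp.const_mul]
    refine (mul_le_mul_of_nonneg_left (bernoulliExp.exp_card_inter_le hp0 _)
      (Real.exp_nonneg _)).trans ?_
    rw [← Real.exp_nat_mul, ← Real.exp_nat_mul, ← Real.exp_add, ← Real.exp_add, Real.exp_le_exp]
    have hA : (0 : ℝ) ≤ #A := by positivity
    have hB : (0 : ℝ) ≤ #B := by positivity
    have h1 : (#(crossPairs A B) : ℝ) ≤ #A * #B := by exact_mod_cast card_crossPairs_le A B
    have h2 : p * #A ≤ 9 * L := by linarith [hP.2]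
    have h3 := mul_le_mul_of_nonneg_left h1 hp0
    have h4 := mul_le_mul_of_nonneg_right h2 hB
    have h5 : 0 ≤ L * #A := mul_nonneg (hp0.trans hpL) hA
    simp only
    nlinarith
  have hsub : ({P | P ≠ (∅, ∅) ∧ p * (#P.1 - 1) < 8 * L} : Finset (Finset V × Finset V)) ⊆
      univ.erase (∅, ∅) := fun P hP => by
    simp only [mem_filter, mem_univ, true_and] at hP
    exact mem_erase.2 ⟨hP.1, mem_univ P⟩
  refine (sum_le_sum h).trans
    ((sum_le_sum_of_subset_of_nonneg hsub fun _ _ _ => by positivity).trans ?_)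
  have h2 := add_sum_erase univ (fun P : Finset V × Finset V =>
    Real.exp (-(2 * L)) ^ #P.1 * Real.exp (-(2 * L)) ^ #P.2) (mem_univ (∅, ∅))
  have h3 := one_add_pow_le_exp (Real.exp_nonneg (-(2 * L))) (Fintype.card V)
  rw [Fintype.sum_prod_type] at h2
  simp only at h2
  rw [← Fintype.sum_mul_sum, sum_finset_pow_card, ← sq] at h2
  have h4 := pow_le_pow_left₀ (by positivity) h3 2
  rw [← Real.exp_nat_mul] at h4
  simp only [card_empty, pow_zero] at h2
  push_cast at h4
  linarith

end Moments

/-! ### A good outcome of the random graph -/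

/-- A random graph has bounded maximum degree, many edges, few vertices in triangles, and no
dense bipartite subgraph between a stable set and a disjoint set. -/
theorem exists_graph_sparse_from_stable {V : Type*} [Fintype V] [DecidableEq V] [Nonempty V]
    {p L : ℝ} (hp0 : 0 ≤ p) (hp1 : p ≤ 1) (hpL : p ≤ L)
    (h : 96 * ((Fintype.card V : ℝ) ^ 2 * p ^ 3) +
      Real.exp (-(p * (Fintype.card V * (Fintype.card V - 1) / 2) / 4)) +
      Fintype.card V * Real.exp (-(p * Fintype.card V)) +
      (Real.exp (Fintype.card V * Real.exp (-(2 * L))) - 1) +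
      (Real.exp (2 * (Fintype.card V * Real.exp (-(2 * L)))) - 1) < 1) :
    ∃ (G : SimpleGraph V) (_ : DecidableRel G.Adj) (T : Finset V),
      (∀ v, (G.degree v : ℝ) ≤ 3 * p * Fintype.card V) ∧
      p * (Fintype.card V * (Fintype.card V - 1) / 4) ≤ ∑ v, (G.degree v : ℝ) ∧
      96 * (#T : ℝ) ≤ Fintype.card V ∧
      (∀ a b c, G.Adj a b → G.Adj a c → G.Adj b c → a ∈ T) ∧
      ∀ A B : Finset V, Disjoint A B → G.IsIndepSet (A : Set V) →
        (#(G.interedges A B) : ℝ) ≤ 20 * L * (#A + #B) := by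
  classical
  have hn : (0 : ℝ) < Fintype.card V := by exact_mod_cast Fintype.card_pos
  have h1 := bernoulliExp_triangles_le (V := V) hp0
  have h2 := bernoulliExp_few_edges_le (V := V) hp0 hp1
  have h3 := bernoulliExp_large_degree_le (V := V) hp0
  have h4 := bernoulliExp_large_stable_le (V := V) (L := L) hp0 hp1
  have h5 := bernoulliExp_dense_pair_le (V := V) hp0 hpL
  set f1 : Finset (Sym2 V) → ℝ := fun E => ∑ t : V × V × V with
        t.1 ≠ t.2.1 ∧ t.1 ≠ t.2.2 ∧ t.2.1 ≠ t.2.2,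
        if ({s(t.1, t.2.1), s(t.1, t.2.2), s(t.2.1, t.2.2)} : Finset (Sym2 V)) ⊆ E
          then (1 : ℝ) else 0 with hf1
  set f2 : Finset (Sym2 V) → ℝ := fun E =>
    Real.exp (p * #(innerPairs (univ : Finset V)) / 4) *
        Real.exp (-(#(E ∩ innerPairs univ) : ℝ)) with hf2
  set f3 : Finset (Sym2 V) → ℝ := fun E => ∑ v : V,
        Real.exp (-(3 * p * Fintype.card V)) *
          Real.exp (#(E ∩ crossPairs {v} univ) : ℝ) with hf3
  set f4 : Finset (Sym2 V) → ℝ := fun E =>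
        ∑ A : Finset V with A.Nonempty ∧ 8 * L ≤ p * (#A - 1),
          Real.exp (-(#(E ∩ innerPairs A) : ℝ)) with hf4
  set f5 : Finset (Sym2 V) → ℝ := fun E =>
        ∑ P : Finset V × Finset V with P ≠ (∅, ∅) ∧ p * (#P.1 - 1) < 8 * L,
          Real.exp (-(20 * L * (#P.1 + #P.2))) *
            Real.exp (#(E ∩ crossPairs P.1 P.2) : ℝ) with hf5
  have hcard : (#(innerPairs (univ : Finset V)) : ℝ) =
      Fintype.card V * (Fintype.card V - 1) / 2 := by rw [card_innerPairs, card_univ]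
  -- All five penalties are nonnegative and each bad event makes one of them at least 1, so a total
  -- below 1 excludes every bad event.
  obtain ⟨E, hE⟩ : ∃ E, 96 / (Fintype.card V : ℝ) * f1 E + f2 E + f3 E + f4 E + f5 E < 1 := by
    refine bernoulliExp.exists_lt_one hp0 hp1 ?_
    rw [bernoulliExp.add, bernoulliExp.add, bernoulliExp.add, bernoulliExp.add,
      bernoulliExp.const_mul]
    have h1' := mul_le_mul_of_nonneg_left h1 (by positivity : 0 ≤ 96 / (Fintype.card V : ℝ))
    have e1 : 96 / (Fintype.card V : ℝ) * ((Fintype.card V : ℝ) ^ 3 * p ^ 3) =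
        96 * ((Fintype.card V : ℝ) ^ 2 * p ^ 3) := by field_simp
    rw [e1] at h1'
    rw [hcard] at h2
    linarith
  have p1 : 0 ≤ 96 / (Fintype.card V : ℝ) * f1 E :=
    mul_nonneg (by positivity) (sum_nonneg fun _ _ => by split_ifs <;> norm_num)
  have p2 : 0 ≤ f2 E := by positivity
  have p3 : 0 ≤ f3 E := sum_nonneg fun _ _ => by positivity
  have p4 : 0 ≤ f4 E := sum_nonneg fun _ _ => by positivity
  have p5 : 0 ≤ f5 E := sum_nonneg fun _ _ => by positivity
  have hstable : ∀ A : Finset V, A.Nonempty →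
      (SimpleGraph.fromEdgeSet (E : Set (Sym2 V))).IsIndepSet (A : Set V) →
      p * (#A - 1) < 8 * L := by
    intro A hne hA
    by_contra! hc
    have hle : Real.exp (-(#(E ∩ innerPairs A) : ℝ)) ≤ f4 E :=
      single_le_sum (f := fun A => Real.exp (-(#(E ∩ innerPairs A) : ℝ)))
        (fun _ _ => by positivity) (mem_filter.2 ⟨mem_univ A, hne, hc⟩)
    rw [inter_innerPairs_eq_empty E hA] at hle
    simp only [card_empty, Nat.cast_zero, neg_zero, Real.exp_zero] at hle
    linarith
  refine ⟨SimpleGraph.fromEdgeSet (E : Set (Sym2 V)), inferInstance,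
    univ.filter fun v => ∃ b c, s(v, b) ∈ E ∧ s(v, c) ∈ E ∧ s(b, c) ∈ E ∧ v ≠ b ∧ v ≠ c ∧ b ≠ c,
    fun v => ?_, ?_, ?_, ?_, ?_⟩
  · have hle : Real.exp (-(3 * p * Fintype.card V)) *
        Real.exp (#(E ∩ crossPairs {v} univ) : ℝ) ≤ f3 E :=
      single_le_sum (f := fun v => Real.exp (-(3 * p * Fintype.card V)) *
        Real.exp (#(E ∩ crossPairs {v} univ) : ℝ)) (fun _ _ => by positivity) (mem_univ v)
    have hlt : Real.exp (-(3 * p * Fintype.card V)) *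
        Real.exp (#(E ∩ crossPairs {v} univ) : ℝ) < 1 := by linarith
    rw [← Real.exp_add, Real.exp_lt_one_iff] at hlt
    have : ((SimpleGraph.fromEdgeSet (E : Set (Sym2 V))).degree v : ℝ) ≤
      #(E ∩ crossPairs {v} univ) := by exact_mod_cast degree_fromEdgeSet_le E v
    linarith
  · have hlt : f2 E < 1 := by linarith
    simp only [hf2] at hlt
    rw [← Real.exp_add, Real.exp_lt_one_iff, hcard] at hlt
    have : (2 * #(E ∩ innerPairs univ) : ℝ) ≤
        ∑ v, ((SimpleGraph.fromEdgeSet (E : Set (Sym2 V))).degree v : ℝ) := by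
      exact_mod_cast two_mul_card_inter_innerPairs_le_sum_degree E
    linarith
  · have hlt : 96 / (Fintype.card V : ℝ) * f1 E < 1 := by linarith
    rw [div_mul_eq_mul_div, div_lt_one hn] at hlt
    refine le_trans (mul_le_mul_of_nonneg_left ?_ (by norm_num)) hlt.le
    simp only [hf1, sum_boole, filter_filter]
    refine Nat.cast_le.2 (le_trans (card_le_card (t := Finset.image Prod.fst _) fun v hv => ?_)
      card_image_le)
    simp only [mem_filter, mem_univ, true_and] at hv
    obtain ⟨b, c, h1, h2, h3, h4, h5, h6⟩ := hv
    refine mem_image.2 ⟨(v, b, c), ?_, rfl⟩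
    simp [insert_subset_iff, *]
  · intro a b c hab hac hbc
    rw [SimpleGraph.fromEdgeSet_adj] at hab hac hbc
    exact mem_filter.2 ⟨mem_univ a, b, c, hab.1, hac.1, hbc.1, hab.2, hac.2, hbc.2⟩
  · intro A B hAB hA
    have hint := card_interedges_fromEdgeSet_le E hAB
    by_cases hP : (A, B) = (∅, ∅)
    · obtain ⟨rfl, rfl⟩ := Prod.mk.inj hP
      simp
    -- The empty set is separate because the strict inequality fails there when `p = L = 0`.
    have hsmall : p * (#A - 1) < 8 * L ∨ A = ∅ := by
      rcases A.eq_empty_or_nonempty with h | h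
      · exact Or.inr h
      · exact Or.inl (hstable A h hA)
    rcases hsmall with hsmall | rfl
    · have hle : Real.exp (-(20 * L * (#A + #B))) * Real.exp (#(E ∩ crossPairs A B) : ℝ) ≤ f5 E :=
        single_le_sum (f := fun P : Finset V × Finset V =>
          Real.exp (-(20 * L * (#P.1 + #P.2))) * Real.exp (#(E ∩ crossPairs P.1 P.2) : ℝ))
          (fun _ _ => by positivity) (mem_filter.2 ⟨mem_univ (A, B), hP, hsmall⟩)
      have hlt : Real.exp (-(20 * L * (#A + #B))) *
        Real.exp (#(E ∩ crossPairs A B) : ℝ) < 1 := by linarith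
      rw [← Real.exp_add, Real.exp_lt_one_iff] at hlt
      have : (#((SimpleGraph.fromEdgeSet (E : Set (Sym2 V))).interedges A B) : ℝ) ≤
        #(E ∩ crossPairs A B) := by exact_mod_cast hint
      linarith
    · have hL : 0 ≤ L := hp0.trans hpL
      have : #((SimpleGraph.fromEdgeSet (E : Set (Sym2 V))).interedges ∅ B) = 0 := by
        refine Nat.eq_zero_of_le_zero (hint.trans ?_)
        exact (card_le_card inter_subset_right).trans ((card_crossPairs_le ∅ B).trans (by simp))
      rw [this]
      push_cast
      positivity

/-! ### Numerical estimates for large `n` -/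

theorem eventually_random_graph_bound : ∀ᶠ n : ℕ in Filter.atTop,
    (n : ℝ) ^ (-(2 : ℝ) / 3) / 6 ≤ Real.log n ∧
    96 * ((n : ℝ) ^ 2 * ((n : ℝ) ^ (-(2 : ℝ) / 3) / 6) ^ 3) +
      Real.exp (-((n : ℝ) ^ (-(2 : ℝ) / 3) / 6 * (n * (n - 1) / 2) / 4)) +
      n * Real.exp (-((n : ℝ) ^ (-(2 : ℝ) / 3) / 6 * n)) +
      (Real.exp (n * Real.exp (-(2 * Real.log n))) - 1) +
      (Real.exp (2 * (n * Real.exp (-(2 * Real.log n)))) - 1) < 1 := by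
  have hlog := Real.tendsto_log_atTop.comp (tendsto_natCast_atTop_atTop (R := ℝ))
  have hlin : ∀ᶠ n : ℕ in Filter.atTop,
      ‖Real.log n‖ ≤ 1 / 12 * ‖(n : ℝ) ^ ((1 : ℝ) / 3)‖ :=
    ((isLittleO_log_rpow_atTop (by norm_num : (0 : ℝ) < 1 / 3)).bound
      (by norm_num : (0 : ℝ) < 1 / 12)).natCast_atTop
  filter_upwards [Filter.eventually_ge_atTop 100, hlin,
    hlog.eventually_ge_atTop 3] with n hn hln hl3
  have hn' : (100 : ℝ) ≤ n := by exact_mod_cast hn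
  have hpos : (0 : ℝ) < n := by linarith
  simp only [Function.comp_apply] at hl3
  set l := Real.log n with hl
  set x := (n : ℝ) ^ ((1 : ℝ) / 3) with hx
  have hx0 : 0 < x := by positivity
  rw [Real.norm_of_nonneg (by linarith), Real.norm_of_nonneg hx0.le] at hln
  have hx3 : x ^ 3 = n := by
    rw [hx, ← Real.rpow_natCast, ← Real.rpow_mul hpos.le]; norm_num
  have hp : (n : ℝ) ^ (-(2 : ℝ) / 3) = 1 / x ^ 2 := by
    rw [hx, ← Real.rpow_natCast, ← Real.rpow_mul hpos.le, one_div, ← Real.rpow_neg hpos.le]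
    norm_num
  rw [hp, ← hx3]
  have hexp : Real.exp (-(2 * l)) = 1 / (x ^ 3) ^ 2 := by
    rw [Real.exp_neg, mul_comm, Real.exp_mul, hl, Real.exp_log hpos, hx3]
    norm_num
  have hx36 : 36 ≤ x := by linarith
  have hxinv : 1 / x ^ 2 ≤ 1 := by
    rw [div_le_one (by positivity)]; nlinarith
  have e1 : 96 * ((x ^ 3) ^ 2 * (1 / x ^ 2 / 6) ^ 3) = 4 / 9 := by field_simp; norm_num
  have e3 : 1 / x ^ 2 / 6 * x ^ 3 = x / 6 := by field_simp
  have e4 : x ^ 3 * Real.exp (-(2 * l)) = 1 / n := by rw [hexp, ← hx3]; field_simp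
  have hninv : 1 / (n : ℝ) ≤ 1 / 100 := one_div_le_one_div_of_le (by norm_num) hn'
  have hsmall : ∀ y : ℝ, 0 ≤ y → y ≤ 1 / 50 → Real.exp y - 1 ≤ 1 / 25 := by
    intro y hy0 hy
    have h := Real.add_one_le_exp (-y)
    have hprod : Real.exp y * Real.exp (-y) = 1 := by rw [← Real.exp_add]; simp
    nlinarith [Real.exp_pos y]
  have hdecay : Real.exp (-3) ≤ 1 / 4 := by
    rw [Real.exp_neg, one_div]
    exact inv_anti₀ (by norm_num) (by linarith [Real.add_one_le_exp 3])
  have hdecay6 : Real.exp (-6) ≤ 1 / 16 := by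
    rw [show (-6 : ℝ) = -3 + -3 by norm_num, Real.exp_add]
    nlinarith [Real.exp_pos (-3)]
  refine ⟨by linarith, ?_⟩
  rw [e1, e3, e4]
  have t2 : Real.exp (-(1 / x ^ 2 / 6 * (x ^ 3 * (x ^ 3 - 1) / 2) / 4)) ≤ 1 / 16 := by
    refine le_trans (Real.exp_le_exp.2 ?_) hdecay6
    have : 1 / x ^ 2 / 6 * (x ^ 3 * (x ^ 3 - 1) / 2) / 4 = x * (x ^ 3 - 1) / 48 := by
      field_simp; ring
    rw [this, hx3]
    nlinarith
  -- Since `12l ≤ x`, the exponent `l - x/6` is at most `-l ≤ -3`.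
  have t3 : x ^ 3 * Real.exp (-(x / 6)) ≤ 1 / 4 := by
    have h1 : x ^ 3 = Real.exp l := by rw [hx3, hl, Real.exp_log hpos]
    rw [h1, ← Real.exp_add]
    refine le_trans (Real.exp_le_exp.2 ?_) hdecay
    linarith
  have t4 := hsmall (1 / n) (by positivity) (by linarith)
  have t5 := hsmall (2 * (1 / n)) (by positivity) (by linarith)
  linarith

/-! ### Assembly -/

theorem theorem13 :
    ∃ C C' C'' : ℝ, 0 < C ∧ 0 < C' ∧ 0 < C'' ∧
      ∃ n₀ : ℕ, ∀ n : ℕ, n₀ ≤ n →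
        ∃ (G : SimpleGraph (Fin n)) (_ : DecidableRel G.Adj),
          G.CliqueFree 3 ∧
          (∀ v : Fin n, C' * (n : ℝ) ^ ((1 : ℝ) / 3) ≤ (G.degree v : ℝ) ∧
            (G.degree v : ℝ) ≤ C'' * (n : ℝ) ^ ((1 : ℝ) / 3)) ∧
          ¬ HasSemiBipartiteInducedSubgraph G (C * Real.log (n : ℝ)) := by
  classical
  obtain ⟨n₀, hn₀⟩ := Filter.eventually_atTop.1 eventually_random_graph_bound
  -- With `pn = n^(1/3)/6`, the degree bounds are `pn/64` and `96 · 3pn`. The average degree is at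
  -- most `2 · 20 · 96^2 log n`, and 41 in place of 40 makes the inequality strict.
  refine ⟨41 * 96 ^ 2, 1 / 384, 48, by norm_num, by norm_num, by norm_num, max n₀ 2,
    fun n hn => ?_⟩
  have hn2 : 2 ≤ n := (le_max_right _ _).trans hn
  have hn2' : (2 : ℝ) ≤ n := by exact_mod_cast hn2
  obtain ⟨hpL, hbound⟩ := hn₀ n ((le_max_left _ _).trans hn)
  have : Nonempty (Fin n) := ⟨⟨0, by omega⟩⟩
  set p := (n : ℝ) ^ (-(2 : ℝ) / 3) / 6 with hp
  have hp0 : 0 < p := by positivity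
  have hp1 : p ≤ 1 := by
    have : (n : ℝ) ^ (-(2 : ℝ) / 3) ≤ 1 :=
      Real.rpow_le_one_of_one_le_of_nonpos (by linarith) (by norm_num)
    linarith
  have hpn : p * n = (n : ℝ) ^ ((1 : ℝ) / 3) / 6 := by
    rw [hp, div_mul_eq_mul_div, ← Real.rpow_add_one (by positivity)]
    norm_num
  have hlog : 0 < Real.log n := Real.log_pos (by linarith)
  obtain ⟨G, _, T, hdeg, hsum, hT, htri, hsparse⟩ :=
    exists_graph_sparse_from_stable (V := Fin n) hp0.le hp1 hpL (by simpa using hbound)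
  simp only [Fintype.card_fin] at hdeg hsum hT
  obtain ⟨W, hWT, hWdeg, hWcard⟩ := exists_core G T (δ := p * n / 64) (by positivity) hdeg
  rw [Fintype.card_fin] at hWcard
  have hW : n ≤ 96 * #W := by
    have hpn0 : 0 < p * n := by positivity
    -- In units of `pn²`, the degree sum is at least 1/8 (as `n ≥ 2`), and the losses to `T` and to
    -- `δ` are at most 1/16 and 1/32. This leaves 1/32, against the degree cap `3pn`.
    have h1 : p * n * n ≤ p * n * (96 * #W) := by nlinarith
    exact_mod_cast le_of_mul_le_mul_left h1 hpn0
  obtain ⟨f, hfW, hfsurj, hfib⟩ := exists_balanced_map (by omega) W hW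
  have hadj : ∀ u v, (G.comap f).Adj u v ↔ G.Adj (f u) (f v) := fun _ _ => Iff.rfl
  refine ⟨G.comap f, inferInstance, ?_, fun v => ⟨?_, ?_⟩, ?_⟩
  · intro s hs
    obtain ⟨a, b, c, hab, hac, hbc, -⟩ := SimpleGraph.is3Clique_iff.1 hs
    exact disjoint_left.1 hWT (hfW a) (htri _ _ _ hab hac hbc)
  · have h1 : G.neighborFinset (f v) ∩ W ⊆ ((G.comap f).neighborFinset v).image f := by
      intro w hw
      obtain ⟨hw1, hw2⟩ := mem_inter.1 hw
      obtain ⟨u, rfl⟩ := hfsurj w hw2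
      refine mem_image_of_mem f ?_
      rw [SimpleGraph.mem_neighborFinset] at hw1 ⊢
      exact hw1
    have h2 : (#(G.neighborFinset (f v) ∩ W) : ℝ) ≤ (G.comap f).degree v := by
      exact_mod_cast (card_le_card h1).trans card_image_le
    have h3 := hWdeg (f v) (hfW v)
    linarith
  · have h1 : (G.comap f).degree v ≤ 96 * G.degree (f v) := by
      refine card_le_mul_card_of_fiber_le (f := f) _ _ (fun u hu => ?_) fun w _ => ?_
      · rw [SimpleGraph.mem_neighborFinset] at hu ⊢
        exact hu
      · exact (card_le_card (filter_subset_filter _ (subset_univ _))).trans (hfib w)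
    have h2 : ((G.comap f).degree v : ℝ) ≤ 96 * G.degree (f v) := by exact_mod_cast h1
    have h3 := hdeg (f v)
    linarith
  · rintro ⟨A, B, -, hne, hA, hd⟩
    have h := card_interedges_comap_le_of_sparse hfib (c := 20 * Real.log n) (by positivity)
      hsparse (B := B) hA
    have hpos : (0 : ℝ) < #A + #B := by
      have : 0 < #A + #B := by
        rcases hne with h | h
        · have := h.card_pos; omega
        · have := h.card_pos; omega
      exact_mod_cast this
    rw [bipAverageDegree, le_div_iff₀ hpos] at hd
    have : 0 < Real.log n * (#A + #B) := mul_pos hlog hpos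
    push_cast at h
    linarith
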